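/- **Setting.** All logarithms without a base are binary. For words $w,v$ let $|w|_v$ be the number of (possibly overlapping) occurrences of $v$ in $w$, with $|w|_\epsilon=|w|$ for the empty word $\epsilon$. The $k$-order empirical entropy of a nonempty word $w$ is $$H_k(w)=-\frac1{|w|}\sum_{|v|=k,\ a\text{ a letter}}|w|_{va}\log\frac{|w|_{va}}{|w|_v},$$ where summands with $|w|_{va}=0$ are $0$. A full grammar $(S',G)$ consists of a starting string $S'$ and one rule for each nonterminal of $G$; its size is the total length of $S'$ and of all right-hand sides of rules, and $|\mathcal N(G)|$ is the number of its nonterminals. *Greedy* starts on the input $S$ with the full grammar $(S,\emptyset)$. In each round it takes a word $w$ with $|w|\ge 2$ that has at least two non-overlapping occurrences in the starting string and the right-hand sides, replaces the non-overlapping occurrences of $w$ (found by scanning from left to right) by a new nonterminal $X$, and adds the rule $X\to w$; here $w$ is chosen such that the resulting full grammar has the smallest possible size (ties are broken arbitrarily). It is run to the end, i.e. it stops at a full grammar that no such replacement makes smaller (it does not matter whether replacements that keep the size unchanged are still carried out). The *fully naive encoding* of a full grammar over an alphabet of size $\sigma$ stores the lengths of all right-hand sides (including the starting string) in unary, followed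 by the concatenation of all right-hand sides, in which every letter and every nonterminal is written with a code of the same length $\lceil\log(\sigma+|\mathcal N(G)|)\rceil$. **Theorem.** Let $S$, $|S|=n$, be a string over an alphabet of size $\sigma$, where $2\le\sigma\le n$, and let $k=o(\log_\sigma n)$. Then the fully naive encoding of every full grammar produced by Greedy on $S$ takes at most $$2|S|H_k(S)+o(|S|\log\sigma)$$ bits. Here $n\to\infty$ and $\sigma$, $k$, $S$ may vary with $n$, uniformly; that is, for every family of inputs $S_i$ over alphabets of sizes $\sigma_i$ with $2\le\sigma_i\le|S_i|$, of orders $k_i\ge0$, and of full grammars produced by Greedy on $S_i$, such that $|S_i|\to\infty$ and $k_i=o(\log_{\sigma_i}|S_i|)$, there are $r_i=o(|S_i|\log\sigma_i)$ such that for each $i$ the $i$-th encoding takes at most $2|S_i|H_{k_i}(S_i)+r_i$ bits. -/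

import Mathlib

open Filter Asymptotics

namespace GreedyGrammar

/-- `occ w v` is the number of (possibly overlapping) occurrences of `v` as a subword of `w`,
counted by starting position. Only the positions `0, …, |w| - 1` are used, so that for the empty
word `occ w [] = |w|`, which is the convention used in the definition of the empirical entropy. -/
def occ {α : Type*} [DecidableEq α] (w v : List α) : ℕ :=
  (List.range w.length).countP (fun i => decide (v <+: w.drop i))

/-- The `k`-order empirical entropy
`H_k(w) = -(1/|w|) ∑_{|v| = k, a letter} |w|_{va} log₂ (|w|_{va} / |w|_v)`
of a word `w` over the alphabet `Fin σ`. Summands with `|w|_{va} = 0` are `0`. -/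
noncomputable def empiricalEntropy {σ : ℕ} (k : ℕ) (w : List (Fin σ)) : ℝ :=
  -(1 / (w.length : ℝ)) *
    ∑ v : Fin k → Fin σ, ∑ a : Fin σ,
      (occ w (List.ofFn v ++ [a]) : ℝ) *
        Real.logb 2 ((occ w (List.ofFn v ++ [a]) : ℝ) / (occ w (List.ofFn v) : ℝ))

/-- Grammar symbols over the alphabet `Fin σ`: `Sum.inl a` is the letter `a`, and `Sum.inr i` is
the `i`-th nonterminal. -/
abbrev GSymbol (σ : ℕ) : Type := Fin σ ⊕ ℕ

/-- A full grammar `(S', G)`: the starting string `S'`, and the list of the right-hand sides of the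
rules of `G`; the `i`-th entry of `rules` is the right-hand side of the nonterminal `Sum.inr i`. -/
structure FullGrammar (σ : ℕ) where
  start : List (GSymbol σ)
  rules : List (List (GSymbol σ))

namespace FullGrammar

variable {σ : ℕ}

/-- All right-hand sides of a full grammar, that of the start symbol first. -/
def rightHandSides (g : FullGrammar σ) : List (List (GSymbol σ)) := g.start :: g.rules

/-- The number of nonterminals of `G` (the start symbol is not counted). -/
def numNonterminals (g : FullGrammar σ) : ℕ := g.rules.length

/-- The size `‖(S', G)‖`: the total length of all right-hand sides. -/
def size (g : FullGrammar σ) : ℕ := g.rightHandSides.flatten.length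

/-- The grammar without rules whose starting string is `S`. -/
def initial (S : List (Fin σ)) : FullGrammar σ := ⟨S.map Sum.inl, []⟩

end FullGrammar

/-- Scan a word from left to right and replace each occurrence of `w` that is met (and does not
overlap one that was replaced before) by the symbol `X`. For nonempty `w` this replaces a maximum
number of pairwise non-overlapping occurrences. -/
def replaceAll {α : Type*} [DecidableEq α] (w : List α) (X : α) : List α → List α
  | [] => []
  | a :: t =>
    if w <+: a :: t then X :: replaceAll w X (t.drop (w.length - 1))
    else a :: replaceAll w X t
termination_by l => l.length
decreasing_by
  all_goals simp only [List.length_drop, List.length_cons]; omega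

variable {σ : ℕ}

/-- Replace the word `w` by a fresh nonterminal `X` in the starting string and in all right-hand
sides, and add the rule `X → w`. -/
def FullGrammar.replace (g : FullGrammar σ) (w : List (GSymbol σ)) : FullGrammar σ where
  start := replaceAll w (Sum.inr g.numNonterminals) g.start
  rules := g.rules.map (replaceAll w (Sum.inr g.numNonterminals)) ++ [w]

/-- One round of Greedy: a word `w` is replaced such that the resulting full grammar is as small as
possible. The choice among several best words is arbitrary. Replacing `f` occurrences of `w`
lowers the size by `(f - 1) (|w| - 1) - 1`, so the condition that the size does not grow says
that `w` has at least two non-overlapping occurrences. -/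
def GreedyStep (g g' : FullGrammar σ) : Prop :=
  ∃ w : List (GSymbol σ), 2 ≤ w.length ∧ g' = g.replace w ∧ g'.size ≤ g.size ∧
    ∀ w' : List (GSymbol σ), 2 ≤ w'.length → g'.size ≤ (g.replace w').size

/-- `g` is a full grammar produced by Greedy on the input `S`: it is reached from the grammar without
rules by rounds of Greedy, and no replacement makes it smaller. Both usual stopping rules are
covered: to stop as soon as no replacement makes the grammar strictly smaller, and to go on
until no word of length at least two has two non-overlapping occurrences. -/
def IsGreedyOutput (S : List (Fin σ)) (g : FullGrammar σ) : Prop :=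
  Relation.ReflTransGen GreedyStep (FullGrammar.initial S) g ∧
    ∀ w : List (GSymbol σ), 2 ≤ w.length → g.size ≤ (g.replace w).size

/-- The number of a symbol: letters come first, then the nonterminals. -/
def symbolIndex : GSymbol σ → ℕ
  | Sum.inl a => a
  | Sum.inr i => σ + i

/-- The `len`-bit code of a symbol: the lowest `len` binary digits of its number. -/
def symbolCode (len : ℕ) (s : GSymbol σ) : List Bool :=
  List.ofFn (fun j : Fin len => (symbolIndex s).testBit j)

/-- The fully naive encoding: the lengths of all right-hand sides in unary, followed by the
concatenation of all right-hand sides, in which each symbol (letter or nonterminal) is given by a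
code of fixed length `⌈log₂ (σ + number of nonterminals)⌉`. -/
def fullyNaiveEncoding (g : FullGrammar σ) : List Bool :=
  g.rightHandSides.flatMap (fun r => List.replicate r.length true ++ [false]) ++
    g.rightHandSides.flatten.flatMap (symbolCode (Nat.clog 2 (σ + g.numNonterminals)))

end GreedyGrammar

/-! Stop Greedy just before the first round that gains less than `t`, where `t` is about `(log
n)^2`. The grammar reached there is at least as large as the final one, has at most `n / t`
nonterminals, and no replacement in it gains more than `t` (`exists_derived_of_isGreedyOutput`).

Cut one occurrence of each nonterminal out of its right-hand sides and split the rest into `m`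
disjoint pairs of adjacent symbols. A cut-out nonterminal pays for the expansion of its rule, so for
every nonnegative superadditive cost the total over the expanded pairs is at most the cost of `S`. A
pair occurring `f` times could be replaced with a gain of at least `f - 2`, so no pair occurs more
than `t + 2` times. This survives expansion because distinct symbols have distinct expansions, which
is the invariant `IsDerived` (`IsDerived.exists_pairs`).

Gibbs' inequality then bounds `m log (m / (t + 2))` by the length of any ideal code for the pairs
(`length_mul_logb_le`). Coding both components of each pair with the order-`k` frequencies of `S`,
paying `k log σ` for the first `k` letters and a geometric code for the length, yields `m log n ≤ n
H_k + o(n log σ)`. The size is about `2m`, and a symbol takes `log n + O(1)` bits. Hence the factor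
2. -/

namespace GreedyGrammar

/-! ### Left-to-right replacement of a word -/

section ReplaceAll

variable {α : Type*} [DecidableEq α] {w : List α} {X : α}

theorem replaceAll_nil : replaceAll w X [] = [] := by
  rw [replaceAll]

theorem replaceAll_cons_of_not_prefix {a : α} {t : List α} (h : ¬ w <+: a :: t) :
    replaceAll w X (a :: t) = a :: replaceAll w X t := by
  rw [replaceAll, if_neg h]

theorem replaceAll_append (hw : w ≠ []) (t : List α) :
    replaceAll w X (w ++ t) = X :: replaceAll w X t := by
  obtain ⟨a, v, rfl⟩ := List.exists_cons_of_ne_nil hw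
  rw [List.cons_append, replaceAll, if_pos ⟨t, by simp⟩]
  simp

theorem replaceAll_induction (hw : w ≠ []) {P : List α → Prop} (nil : P [])
    (hit : ∀ t, P t → P (w ++ t)) (miss : ∀ a t, ¬ w <+: a :: t → P t → P (a :: t))
    (u : List α) : P u := by
  induction hn : u.length using Nat.strong_induction_on generalizing u with
  | _ n ih =>
    have hpos := List.length_pos_of_ne_nil hw
    by_cases h : w <+: u
    · obtain ⟨t, rfl⟩ := h
      exact hit t (ih t.length (by rw [← hn, List.length_append]; omega) t rfl)
    · cases u with
      | nil => exact nil
      | cons a t => exact miss a t h (ih t.length (by rw [← hn, List.length_cons]; omega) t rfl)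

theorem replaceAll_eq_self {u : List α} (h : ¬ w <:+: u) : replaceAll w X u = u := by
  induction u with
  | nil => exact replaceAll_nil
  | cons a t ih =>
    rw [replaceAll_cons_of_not_prefix fun h' => h h'.isInfix,
      ih fun h' => h (h'.trans (List.suffix_cons a t).isInfix)]

theorem replaceAll_self (hw : w ≠ []) : replaceAll w X w = [X] := by
  simpa [replaceAll_nil] using replaceAll_append (X := X) hw []

theorem mem_replaceAll (hw : w ≠ []) {s : α} (u : List α) (h : s ∈ replaceAll w X u) :
    s = X ∨ s ∈ u := by
  induction u using replaceAll_induction hw with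
  | nil => simp [replaceAll_nil] at h
  | hit t ih =>
    rw [replaceAll_append hw, List.mem_cons] at h
    grind
  | miss a t ha ih =>
    rw [replaceAll_cons_of_not_prefix ha, List.mem_cons] at h
    grind

theorem mem_replaceAll_or_mem (hw : w ≠ []) {s : α} (u : List α) (h : s ∈ u) :
    s ∈ replaceAll w X u ∨ s ∈ w := by
  induction u using replaceAll_induction hw with
  | nil => simp at h
  | hit t ih =>
    rw [replaceAll_append hw]
    grind
  | miss a t ha ih =>
    rw [replaceAll_cons_of_not_prefix ha]
    grind

theorem replaceAll_mem_of_infix (hw : w ≠ []) (u : List α) (h : w <:+: u) :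
    X ∈ replaceAll w X u := by
  induction u using replaceAll_induction hw with
  | nil => exact absurd (List.eq_nil_of_infix_nil h) hw
  | hit t ih => simp [replaceAll_append hw]
  | miss a t ha ih =>
    rw [replaceAll_cons_of_not_prefix ha]
    rcases List.infix_cons_iff.1 h with h | h
    · exact absurd h ha
    · exact List.mem_cons_of_mem _ (ih h)

theorem replaceAll_flatMap {β : Type*} (hw : w ≠ []) {e e' : α → List β}
    (hX : e' X = w.flatMap e) (u : List α) (hu : ∀ s ∈ u, e' s = e s) :
    (replaceAll w X u).flatMap e' = u.flatMap e := by
  induction u using replaceAll_induction hw with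
  | nil => simp [replaceAll_nil]
  | hit t ih =>
    rw [replaceAll_append hw, List.flatMap_cons, List.flatMap_append, hX,
      ih fun s hs => hu s (by simp [hs])]
  | miss a t ha ih =>
    rw [replaceAll_cons_of_not_prefix ha, List.flatMap_cons, List.flatMap_cons,
      hu a (by simp), ih fun s hs => hu s (by simp [hs])]

/-- A replaced occurrence has become a single symbol, so no cut of the result falls inside it.
Truncating the word on the right cannot create a new prefix `w`, so the scan of the left part makes
the same choices. -/
theorem replaceAll_eq_append (hw : w ≠ []) (u : List α) {p q : List α}
    (h : replaceAll w X u = p ++ q) :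
    ∃ u₁ u₂, u = u₁ ++ u₂ ∧ replaceAll w X u₁ = p ∧ replaceAll w X u₂ = q := by
  cases p with
  | nil => exact ⟨[], u, rfl, replaceAll_nil, h⟩
  | cons x p =>
    induction u using replaceAll_induction hw generalizing x p with
    | nil => simp [replaceAll_nil] at h
    | hit t ih =>
      rw [replaceAll_append hw, List.cons_append, List.cons.injEq] at h
      obtain ⟨rfl, h⟩ := h
      cases p with
      | nil => exact ⟨w, t, rfl, replaceAll_self hw, h⟩
      | cons y p =>
        obtain ⟨u₁, u₂, rfl, h₁, h₂⟩ := ih y p h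
        exact ⟨w ++ u₁, u₂, by simp, by rw [replaceAll_append hw, h₁], h₂⟩
    | miss a t ha ih =>
      rw [replaceAll_cons_of_not_prefix ha, List.cons_append, List.cons.injEq] at h
      obtain ⟨rfl, h⟩ := h
      have key : ∀ u₁ u₂, t = u₁ ++ u₂ → replaceAll w X (a :: u₁) = a :: replaceAll w X u₁ := by
        rintro u₁ u₂ rfl
        exact replaceAll_cons_of_not_prefix fun h' => ha (h'.trans ⟨u₂, by simp⟩)
      cases p with
      | nil => exact ⟨[a], t, rfl, by rw [key [] t rfl, replaceAll_nil], h⟩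
      | cons y p =>
        obtain ⟨u₁, u₂, ht, h₁, h₂⟩ := ih y p h
        exact ⟨a :: u₁, u₂, by rw [ht, List.cons_append], by rw [key u₁ u₂ ht, h₁], h₂⟩

theorem exists_infix_of_infix_replaceAll (hw : w ≠ []) {u v : List α}
    (h : v <:+: replaceAll w X u) : ∃ v', v' <:+: u ∧ replaceAll w X v' = v := by
  obtain ⟨p, q, h⟩ := h
  obtain ⟨u₁, u₂, rfl, h₁, -⟩ := replaceAll_eq_append hw u h.symm
  obtain ⟨u₃, u₄, rfl, -, h₂⟩ := replaceAll_eq_append hw u₁ h₁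
  exact ⟨u₄, ⟨u₃, u₂, rfl⟩, h₂⟩

/-- A new first symbol can shift all later matches when `a = b`. After a match of `a b`, both
inequalities for the word that remains are needed to compare with the scan that starts at `b`. -/
theorem length_replaceAll_pair_cons (a b : α) (x : α) (t : List α) :
    (replaceAll [a, b] X t).length ≤ (replaceAll [a, b] X (x :: t)).length ∧
      (replaceAll [a, b] X (x :: t)).length ≤ (replaceAll [a, b] X t).length + 1 := by
  induction hn : t.length using Nat.strong_induction_on generalizing x t with
  | _ n ih =>
    by_cases h : [a, b] <+: x :: t
    · obtain ⟨t', ht⟩ := h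
      obtain ⟨rfl, rfl⟩ : a = x ∧ b :: t' = t := by simpa using ht
      have h₁ := ih t'.length (by rw [← hn]; simp) b t' rfl
      have h₂ := replaceAll_append (w := [a, b]) (X := X) (by simp) t'
      rw [List.cons_append, List.cons_append, List.nil_append] at h₂
      rw [h₂, List.length_cons]
      omega
    · rw [replaceAll_cons_of_not_prefix h, List.length_cons]
      omega

theorem length_replaceAll_pair_append (a b : α) (u v : List α) :
    (replaceAll [a, b] X (u ++ v)).length ≤
      (replaceAll [a, b] X u).length + (replaceAll [a, b] X v).length := by
  induction u using replaceAll_induction (w := [a, b]) (by simp) with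
  | nil => simp [replaceAll_nil]
  | hit t ih =>
    rw [List.append_assoc, replaceAll_append (by simp), replaceAll_append (by simp)]
    simp only [List.length_cons]
    omega
  | miss x t hx ih =>
    have := (length_replaceAll_pair_cons (X := X) a b x (t ++ v)).2
    rw [replaceAll_cons_of_not_prefix hx, List.cons_append, List.length_cons]
    omega

end ReplaceAll

/-! ### Disjoint pairs, and cutting words under superadditive functionals -/

section Pairs

variable {β : Type*}

/-- Cut a word into consecutive disjoint pairs of symbols, dropping a last single symbol. -/
def consecutivePairs : List β → List (β × β)
  | a :: b :: t => (a, b) :: consecutivePairs t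
  | _ => []

theorem length_le_consecutivePairs (u : List β) :
    u.length ≤ 2 * (consecutivePairs u).length + 1 := by
  induction u using consecutivePairs.induct with
  | case1 a b t ih => simp only [consecutivePairs, List.length_cons]; omega
  | case2 u h =>
    match u, h with
    | [], _ => simp
    | [a], _ => simp
    | a :: b :: t, h => exact absurd rfl (h a b t)

theorem mem_of_mem_consecutivePairs {u : List β} {p : β × β} (hp : p ∈ consecutivePairs u) :
    p.1 ∈ u ∧ p.2 ∈ u := by
  induction u using consecutivePairs.induct with
  | case1 a b t ih =>
    rw [consecutivePairs, List.mem_cons] at hp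
    grind
  | case2 u h =>
    rw [consecutivePairs] at hp
    · simp at hp
    · exact h

theorem sum_consecutivePairs_le {F : List β → ℝ} (hF₀ : ∀ u, 0 ≤ F u)
    (hF : ∀ u v, F u + F v ≤ F (u ++ v)) (u : List β) :
    ((consecutivePairs u).map fun p => F [p.1] + F [p.2]).sum ≤ F u := by
  induction u using consecutivePairs.induct with
  | case1 a b t ih =>
    have h₁ := hF [a] [b]
    have h₂ := hF [a, b] t
    simp only [consecutivePairs, List.map_cons, List.sum_cons, List.cons_append,
      List.nil_append] at *
    linarith
  | case2 u h =>
    rw [consecutivePairs]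
    · simpa using hF₀ u
    · exact h

/-- The scan may match other occurrences than the pairs counted here. Subadditivity of the replaced
length shows that it still saves at least as much, without an appeal to optimality of the scan. -/
theorem length_replaceAll_pair_add_count [DecidableEq β] {X : β} (a b : β) (u : List β) :
    (replaceAll [a, b] X u).length + (consecutivePairs u).countP (fun p => p = (a, b)) ≤
      u.length := by
  have hle : ∀ v : List β, (replaceAll [a, b] X v).length ≤ v.length := by
    intro v
    induction v with
    | nil => simp [replaceAll_nil]
    | cons x t ih =>
      have := (length_replaceAll_pair_cons (X := X) a b x t).2
      rw [List.length_cons]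
      omega
  induction u using consecutivePairs.induct with
  | case1 x y t ih =>
    have h₁ := length_replaceAll_pair_append (X := X) a b [x, y] t
    have h₂ := hle [x, y]
    rw [consecutivePairs, List.countP_cons]
    simp only [List.cons_append, List.nil_append, List.length_cons, List.length_nil,
      decide_eq_true_eq, Prod.mk.injEq] at *
    split_ifs with h
    · obtain ⟨rfl, rfl⟩ := h
      rw [replaceAll_self (by simp)] at h₁
      simp only [List.length_cons, List.length_nil] at h₁
      omega
    · omega
  | case2 u h =>
    rw [consecutivePairs]
    · simpa using hle u
    · exact h

theorem exists_lt_getElem_eq_of_two_le_countP [DecidableEq β] {l : List β} {w : β}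
    (h : 2 ≤ l.countP (fun r => r = w)) :
    ∃ i j : Fin l.length, i < j ∧ l[i] = w ∧ l[j] = w := by
  have h' : 2 ≤ l.count w := h
  rw [← List.duplicate_iff_two_le_count, List.duplicate_iff_exists_distinct_get] at h'
  obtain ⟨i, j, hij, hi, hj⟩ := h'
  exact ⟨i, j, hij, hi.symm, hj.symm⟩

/-- Cut one occurrence of each of the symbols `Xs` out of the words `L`. -/
theorem exists_cut (Xs : List β) (hXs : Xs.Nodup) (L : List (List β))
    (h : ∀ X ∈ Xs, ∃ r ∈ L, X ∈ r) :
    ∃ L' : List (List β), L'.length ≤ L.length + Xs.length ∧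
      (∀ r' ∈ L', ∃ r ∈ L, ∀ s ∈ r', s ∈ r) ∧
      ∀ F : List β → ℝ, (∀ u v, F u + F v ≤ F (u ++ v)) →
        (L'.map F).sum + (Xs.map fun X => F [X]).sum ≤ (L.map F).sum := by
  induction Xs generalizing L with
  | nil => exact ⟨L, by simp, fun r hr => ⟨r, hr, fun s hs => hs⟩, fun F _ => by simp⟩
  | cons X Xs ih =>
    obtain ⟨r, hr, hX⟩ := h X (by simp)
    obtain ⟨A, D, rfl⟩ := List.append_of_mem hr
    obtain ⟨u, v, rfl⟩ := List.append_of_mem hX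
    rw [List.nodup_cons] at hXs
    obtain ⟨L', h₁, h₂, h₃⟩ := ih hXs.2 (A ++ u :: v :: D) (by
      intro Y hY
      have hne : Y ≠ X := fun h => hXs.1 (h ▸ hY)
      obtain ⟨r, hr, hYr⟩ := h Y (by simp [hY])
      simp only [List.mem_append, List.mem_cons] at hr
      rcases hr with hr | rfl | hr
      · exact ⟨r, by simp [hr], hYr⟩
      · simp only [List.mem_append, List.mem_cons, hne, false_or] at hYr
        rcases hYr with hYr | hYr
        · exact ⟨u, by simp, hYr⟩
        · exact ⟨v, by simp, hYr⟩
      · exact ⟨r, by simp [hr], hYr⟩)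
    refine ⟨L', ?_, ?_, ?_⟩
    · simp only [List.length_append, List.length_cons] at *
      omega
    · intro r' hr'
      obtain ⟨r, hr, hs⟩ := h₂ r' hr'
      simp only [List.mem_append, List.mem_cons] at hr
      rcases hr with hr | rfl | rfl | hr
      · exact ⟨r, by simp [hr], hs⟩
      · exact ⟨r ++ X :: v, by simp, fun s h => by simp [hs s h]⟩
      · exact ⟨u ++ X :: r, by simp, fun s h => by simp [hs s h]⟩
      · exact ⟨r, by simp [hr], hs⟩
    · intro F hF
      have h₄ := h₃ F hF
      have h₅ := hF u ([X] ++ v)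
      have h₆ := hF [X] v
      simp only [List.map_append, List.map_cons, List.sum_append, List.sum_cons,
        List.cons_append, List.nil_append] at *
      linarith

end Pairs

/-! ### Expansions recover the symbols; the grammar at the threshold `t` -/

section Invariant

variable {σ : ℕ}

theorem FullGrammar.size_eq (g : FullGrammar σ) :
    g.size = g.start.length + (g.rules.map List.length).sum := by
  simp [FullGrammar.size, FullGrammar.rightHandSides, List.length_flatten]

theorem FullGrammar.size_eq_sum (g : FullGrammar σ) :
    g.size = (g.rightHandSides.map List.length).sum := by
  simp [FullGrammar.size, List.length_flatten]

theorem FullGrammar.size_replace (g : FullGrammar σ) (w : List (GSymbol σ)) :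
    (g.replace w).size = (g.rightHandSides.map fun r =>
      (replaceAll w (Sum.inr g.numNonterminals) r).length).sum + w.length := by
  rw [FullGrammar.size_eq]
  simp [FullGrammar.replace, FullGrammar.rightHandSides, Function.comp_def, add_assoc]

theorem FullGrammar.numNonterminals_replace (g : FullGrammar σ) (w : List (GSymbol σ)) :
    (g.replace w).numNonterminals = g.numNonterminals + 1 := by
  simp [FullGrammar.replace, FullGrammar.numNonterminals]

theorem FullGrammar.mem_rightHandSides_replace {g : FullGrammar σ} {w r : List (GSymbol σ)} :
    r ∈ (g.replace w).rightHandSides ↔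
      (∃ r' ∈ g.rightHandSides, replaceAll w (Sum.inr g.numNonterminals) r' = r) ∨ r = w := by
  simp only [rightHandSides, replace, List.mem_cons, List.mem_append, List.mem_map]
  grind

/-- The properties that Greedy maintains: `e` is the expansion of symbols to words, `ρ` is the
composition of all replacements carried out so far, which recovers from its expansion each
symbol, each factor of the starting string, and each proper factor of a rule. -/
structure IsDerived (S : List (Fin σ)) (g : FullGrammar σ) (e : GSymbol σ → List (Fin σ))
    (ρ : List (Fin σ) → List (GSymbol σ)) : Prop where
  letter : ∀ a, e (Sum.inl a) = [a]
  start : g.start.flatMap e = S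
  rule : ∀ i (h : i < g.rules.length), e (Sum.inr i) = g.rules[i].flatMap e
  bound : ∀ r ∈ g.rightHandSides, ∀ i, Sum.inr i ∈ r → i < g.numNonterminals
  used : ∀ i < g.numNonterminals, ∃ r ∈ g.rightHandSides, Sum.inr i ∈ r
  isInfix : ∀ r ∈ g.rightHandSides, r.flatMap e <:+: S
  canon_letter : ∀ a, ρ [a] = [Sum.inl a]
  canon_nonterminal : ∀ i < g.numNonterminals, ρ (e (Sum.inr i)) = [Sum.inr i]
  canon_start : ∀ u, u <:+: g.start → ρ (u.flatMap e) = u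
  canon_rule : ∀ r ∈ g.rules, ∀ u, u <:+: r → u ≠ r → ρ (u.flatMap e) = u

theorem IsDerived.initial (S : List (Fin σ)) :
    IsDerived S (FullGrammar.initial S) (Sum.elim (fun a => [a]) fun _ => [])
      (List.map Sum.inl) where
  letter _ := rfl
  start := by simp [FullGrammar.initial, List.flatMap_map]
  rule i h := by simp [FullGrammar.initial] at h
  bound r hr i hi := by
    simp only [FullGrammar.initial, FullGrammar.rightHandSides, List.mem_singleton] at hr
    simp [hr] at hi
  used i hi := by simp [FullGrammar.initial, FullGrammar.numNonterminals] at hi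
  isInfix r hr := by
    simp only [FullGrammar.initial, FullGrammar.rightHandSides, List.mem_singleton] at hr
    simp [hr, List.flatMap_map]
  canon_letter _ := rfl
  canon_nonterminal i hi := by simp [FullGrammar.initial, FullGrammar.numNonterminals] at hi
  canon_start u hu := by
    have h : ∀ s ∈ u, ∃ a, s = Sum.inl a := by
      intro s hs
      have := hu.subset hs
      simp only [FullGrammar.initial, List.mem_map] at this
      obtain ⟨a, -, rfl⟩ := this
      exact ⟨a, rfl⟩
    clear hu
    induction u with
    | nil => rfl
    | cons s t ih =>
      obtain ⟨a, rfl⟩ := h s (by simp)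
      simpa using ih fun s hs => h s (by simp [hs])
  canon_rule r hr := by simp [FullGrammar.initial] at hr

/-- On the symbols in use, `ρ` is a left inverse of expansion. -/
theorem IsDerived.injective {S : List (Fin σ)} {g : FullGrammar σ} {e : GSymbol σ → List (Fin σ)}
    {ρ : List (Fin σ) → List (GSymbol σ)} (h : IsDerived S g e ρ) {r r' : List (GSymbol σ)}
    (hr : r ∈ g.rightHandSides) (hr' : r' ∈ g.rightHandSides) {s s' : GSymbol σ} (hs : s ∈ r)
    (hs' : s' ∈ r') (hss : e s = e s') : s = s' := by
  have key : ∀ r ∈ g.rightHandSides, ∀ s ∈ r, ρ (e s) = [s] := by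
    rintro r hr (a | i) hs
    · rw [h.letter, h.canon_letter]
    · exact h.canon_nonterminal i (h.bound r hr i hs)
  have := key r hr s hs
  rw [hss, key r' hr' s' hs', List.cons.injEq] at this
  exact this.1.symm

/-- A word whose replacement does not increase the size is recovered by `ρ` from its expansion,
since at most one of its occurrences is a whole rule. -/
theorem IsDerived.canon_of_size_le {S : List (Fin σ)} {g : FullGrammar σ}
    {e : GSymbol σ → List (Fin σ)} {ρ : List (Fin σ) → List (GSymbol σ)}
    (h : IsDerived S g e ρ) {w : List (GSymbol σ)} (hw : 2 ≤ w.length)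
    (hs : (g.replace w).size ≤ g.size) : ρ (w.flatMap e) = w := by
  by_contra hne
  have hw₀ : w ≠ [] := by rintro rfl; simp at hw
  set X : GSymbol σ := Sum.inr g.numNonterminals with hX
  -- If `ρ` does not recover `w`, then `w` is no factor of the starting string and no proper factor
  -- of a rule, so only rules equal to `w` change.
  have h₁ : replaceAll w X g.start = g.start :=
    replaceAll_eq_self fun hi => hne (h.canon_start w hi)
  have h₂ : ∀ r ∈ g.rules, r.length =
      (replaceAll w X r).length + if r = w then w.length - 1 else 0 := by
    intro r hr
    split_ifs with hrw
    · rw [hrw, replaceAll_self hw₀, List.length_singleton]; omega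
    · rw [replaceAll_eq_self fun hi => hne (h.canon_rule r hr w hi (Ne.symm hrw))]; simp
  have h₃ : (g.rules.map List.length).sum =
      (g.rules.map fun r => (replaceAll w X r).length).sum +
        g.rules.countP (fun r => r = w) * (w.length - 1) := by
    have : ∀ l : List (List (GSymbol σ)), (∀ r ∈ l, r.length =
        (replaceAll w X r).length + if r = w then w.length - 1 else 0) →
        (l.map List.length).sum = (l.map fun r => (replaceAll w X r).length).sum +
        l.countP (fun r => r = w) * (w.length - 1) := by
      intro l hl
      induction l with
      | nil => simp
      | cons r l ih =>
        have h₄ := ih fun r hr => hl r (by simp [hr])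
        have h₅ := hl r (by simp)
        simp only [List.map_cons, List.sum_cons, List.countP_cons, decide_eq_true_eq,
          add_mul, ite_mul, one_mul, zero_mul]
        omega
    exact this _ h₂
  -- Two equal rules would give two nonterminals the same expansion, but `ρ` tells them apart.
  have h₄ : g.rules.countP (fun r => r = w) ≤ 1 := by
    by_contra hc
    have : 2 ≤ g.rules.countP (fun r => r = w) := by omega
    obtain ⟨i, j, hij, hi, hj⟩ := exists_lt_getElem_eq_of_two_le_countP this
    have hij' : e (Sum.inr i) = e (Sum.inr j) := by
      rw [h.rule i i.2, h.rule j j.2]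
      exact congrArg _ (hi.trans hj.symm)
    have hi' := h.canon_nonterminal i i.2
    rw [hij', h.canon_nonterminal j j.2] at hi'
    simp only [List.cons.injEq, Sum.inr.injEq, and_true] at hi'
    exact absurd hi' (by have := hij; rw [Fin.lt_def] at this; omega)
  have h₅ := g.size_replace w
  rw [g.size_eq] at hs
  simp only [FullGrammar.rightHandSides, List.map_cons, List.sum_cons, ← hX, h₁] at h₅
  -- At most `|w| - 1` symbols are saved, while the new rule costs `|w|`.
  have h₆ := Nat.mul_le_mul_right (w.length - 1) h₄
  omega

theorem FullGrammar.exists_infix_of_size_le {g : FullGrammar σ} {w : List (GSymbol σ)}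
    (hw : 2 ≤ w.length) (hs : (g.replace w).size ≤ g.size) :
    ∃ r ∈ g.rightHandSides, w <:+: r := by
  by_contra! hc
  rw [g.size_replace, g.size_eq_sum, List.map_congr_left (g := List.length)
    fun r hr => by rw [replaceAll_eq_self (hc r hr)]] at hs
  omega

/-- A factor of a rewritten right-hand side is the image of a factor `v` of the old one; the old `ρ`
recovers `v`, and one more replacement gives the factor. Proper factors of the new rule `w` are too
short to be changed. -/
theorem IsDerived.replace {S : List (Fin σ)} {g : FullGrammar σ} {e : GSymbol σ → List (Fin σ)}
    {ρ : List (Fin σ) → List (GSymbol σ)} (h : IsDerived S g e ρ) {w : List (GSymbol σ)}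
    (hw : 2 ≤ w.length) (hs : (g.replace w).size ≤ g.size) :
    IsDerived S (g.replace w)
      (Function.update e (Sum.inr g.numNonterminals) (w.flatMap e))
      (fun y => replaceAll w (Sum.inr g.numNonterminals) (ρ y)) := by
  have hw₀ : w ≠ [] := by rintro rfl; simp at hw
  obtain ⟨r₀, hr₀, hwr₀⟩ := FullGrammar.exists_infix_of_size_le hw hs
  have hcw := h.canon_of_size_le hw hs
  set X : GSymbol σ := Sum.inr g.numNonterminals with hX
  set e' := Function.update e X (w.flatMap e) with he'
  have heX : e' X = w.flatMap e := Function.update_self ..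
  have hes : ∀ r ∈ g.rightHandSides, ∀ s ∈ r, e' s = e s := by
    intro r hr s hs
    refine Function.update_of_ne ?_ _ _
    rintro rfl
    exact lt_irrefl _ (h.bound r hr _ hs)
  have hflat : ∀ r ∈ g.rightHandSides, ∀ u, u <:+: r → u.flatMap e' = u.flatMap e := by
    intro r hr u hu
    exact List.flatMap_congr fun s hs => hes r hr s (hu.subset hs)
  have hrep : ∀ r ∈ g.rightHandSides, ∀ u, u <:+: r →
      (replaceAll w X u).flatMap e' = u.flatMap e := by
    intro r hr u hu
    exact replaceAll_flatMap hw₀ heX u fun s hs => hes r hr s (hu.subset hs)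
  have hmem : ∀ r ∈ g.rules, r ∈ g.rightHandSides := fun r hr => List.mem_cons_of_mem _ hr
  have hstart : g.start ∈ g.rightHandSides := List.mem_cons_self ..
  have hwflat : w.flatMap e' = w.flatMap e := hflat r₀ hr₀ w hwr₀
  have hnum := g.numNonterminals_replace w
  have hshort : ∀ u : List (GSymbol σ), u.length < w.length → replaceAll w X u = u :=
    fun u hu => replaceAll_eq_self fun hi => absurd hi.length_le (by omega)
  have hrule : ∀ i < g.numNonterminals, e' (Sum.inr i) = e (Sum.inr i) := by
    intro i hi
    refine Function.update_of_ne ?_ _ _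
    rw [hX, Ne, Sum.inr.injEq]
    omega
  refine ⟨?_, ?_, ?_, ?_, ?_, ?_, ?_, ?_, ?_, ?_⟩
  · intro a
    rw [he', Function.update_of_ne (by simp [hX]), h.letter]
  · exact (hrep _ hstart _ List.infix_rfl).trans h.start
  · intro i hi
    simp only [FullGrammar.replace, List.length_append, List.length_map, List.length_cons,
      List.length_nil] at hi
    rcases Nat.lt_or_ge i g.rules.length with hi' | hi'
    · rw [hrule i hi', h.rule i hi']
      simp only [FullGrammar.replace]
      rw [List.getElem_append_left (by simpa using hi'), List.getElem_map,
        ← hrep _ (hmem _ (List.getElem_mem hi')) _ List.infix_rfl]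
    · obtain rfl : i = g.rules.length := by omega
      simp only [FullGrammar.replace]
      rw [List.getElem_append_right (by simp)]
      simpa [hwflat, hX, FullGrammar.numNonterminals] using heX
  · intro r hr i hi
    rw [hnum]
    rcases FullGrammar.mem_rightHandSides_replace.1 hr with ⟨r', hr', rfl⟩ | rfl
    · rcases mem_replaceAll hw₀ _ hi with hi | hi
      · rw [Sum.inr.injEq] at hi; omega
      · exact (h.bound r' hr' i hi).trans (Nat.lt_succ_self _)
    · exact (h.bound r₀ hr₀ i (hwr₀.subset hi)).trans (Nat.lt_succ_self _)
  · intro i hi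
    rw [hnum] at hi
    rcases Nat.lt_succ_iff_lt_or_eq.1 hi with hi | rfl
    · obtain ⟨r, hr, hir⟩ := h.used i hi
      rcases mem_replaceAll_or_mem (X := X) hw₀ r hir with h' | h'
      · exact ⟨_, FullGrammar.mem_rightHandSides_replace.2 (Or.inl ⟨r, hr, rfl⟩), h'⟩
      · exact ⟨w, FullGrammar.mem_rightHandSides_replace.2 (Or.inr rfl), h'⟩
    · exact ⟨_, FullGrammar.mem_rightHandSides_replace.2 (Or.inl ⟨r₀, hr₀, rfl⟩),
        replaceAll_mem_of_infix hw₀ r₀ hwr₀⟩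
  · intro r hr
    rcases FullGrammar.mem_rightHandSides_replace.1 hr with ⟨r', hr', rfl⟩ | rfl
    · rw [hrep r' hr' r' List.infix_rfl]
      exact h.isInfix r' hr'
    · rw [hwflat]
      refine List.IsInfix.trans ?_ (h.isInfix r₀ hr₀)
      obtain ⟨p, q, rfl⟩ := hwr₀
      exact ⟨p.flatMap e, q.flatMap e, by simp⟩
  · intro a
    rw [h.canon_letter, hshort _ (lt_of_lt_of_le Nat.one_lt_two hw)]
  · intro i hi
    rw [hnum] at hi
    rcases Nat.lt_succ_iff_lt_or_eq.1 hi with hi | rfl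
    · rw [hrule i hi, h.canon_nonterminal i hi, hshort _ (lt_of_lt_of_le Nat.one_lt_two hw)]
    · rw [heX, hcw, replaceAll_self hw₀]
  · intro u hu
    obtain ⟨v, hv, rfl⟩ := exists_infix_of_infix_replaceAll hw₀ hu
    rw [hrep _ hstart v hv, h.canon_start v hv]
  · intro r hr u hu hur
    simp only [FullGrammar.replace, List.mem_append, List.mem_map, List.mem_singleton] at hr
    rcases hr with ⟨r, hr, rfl⟩ | rfl
    · obtain ⟨v, hv, rfl⟩ := exists_infix_of_infix_replaceAll hw₀ hu
      rw [hrep _ (hmem r hr) v hv, h.canon_rule r hr v hv (by rintro rfl; exact hur rfl)]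
    · have hlt : u.length < r.length :=
        lt_of_le_of_ne hu.length_le fun h' => hur (hu.eq_of_length h')
      have hur₀ := hu.trans hwr₀
      rw [hflat r₀ hr₀ u hur₀]
      have : ρ (u.flatMap e) = u := by
        rcases List.mem_cons.1 hr₀ with rfl | hr₀
        · exact h.canon_start u hur₀
        · refine h.canon_rule r₀ hr₀ u hur₀ ?_
          rintro rfl
          exact absurd hwr₀.length_le (by omega)
      rw [this, hshort u hlt]

/-- Every grammar produced by Greedy is no larger than one that arose from replacements which all
gained at least `t`, and in which no replacement gains more than `t`. -/
theorem exists_derived_of_isGreedyOutput {S : List (Fin σ)} {g : FullGrammar σ}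
    (hg : IsGreedyOutput S g) (t : ℕ) :
    ∃ (g₁ : FullGrammar σ) (e : GSymbol σ → List (Fin σ)) (ρ : List (Fin σ) → List (GSymbol σ)),
      IsDerived S g₁ e ρ ∧ g.size ≤ g₁.size ∧ t * g₁.numNonterminals + g₁.size ≤ S.length ∧
      ∀ w : List (GSymbol σ), 2 ≤ w.length → g₁.size ≤ (g₁.replace w).size + t := by
  have key : ∀ g, Relation.ReflTransGen GreedyStep (FullGrammar.initial S) g →
      (∃ e ρ, IsDerived S g e ρ ∧ t * g.numNonterminals + g.size ≤ S.length) ∨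
      ∃ (g₁ : FullGrammar σ) (e : GSymbol σ → List (Fin σ))
        (ρ : List (Fin σ) → List (GSymbol σ)),
        IsDerived S g₁ e ρ ∧ g.size ≤ g₁.size ∧ t * g₁.numNonterminals + g₁.size ≤ S.length ∧
        ∀ w : List (GSymbol σ), 2 ≤ w.length → g₁.size ≤ (g₁.replace w).size + t := by
    intro g hg
    induction hg with
    | refl =>
      refine Or.inl ⟨_, _, IsDerived.initial S, ?_⟩
      simp [FullGrammar.initial, FullGrammar.numNonterminals, FullGrammar.size_eq]
    | tail _ hstep ih =>
      obtain ⟨w, hw, rfl, hs, hmin⟩ := hstep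
      rcases ih with ⟨e, ρ, h, hle⟩ | ⟨g₁, e, ρ, h, hle, hsz, hgain⟩
      · rename_i g₀ _
        -- At the first gain below `t` the grammar `g₀` is kept for good: by the greedy choice no
        -- other word gains more there, and later rounds never enlarge the grammar.
        by_cases ht : (g₀.replace w).size + t ≤ g₀.size
        · refine Or.inl ⟨_, _, h.replace hw hs, ?_⟩
          rw [FullGrammar.numNonterminals_replace]
          exact le_trans (by rw [mul_add]; omega) (le_trans (Nat.add_le_add_left ht _) hle)
        · exact Or.inr ⟨_, e, ρ, h, hs, hle, fun w' hw' => by have := hmin w' hw'; omega⟩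
      · exact Or.inr ⟨g₁, e, ρ, h, hs.trans hle, hsz, hgain⟩
  rcases key g hg.1 with ⟨e, ρ, h, hle⟩ | h
  · exact ⟨g, e, ρ, h, le_rfl, hle, fun w hw => (hg.2 w hw).trans (Nat.le_add_right _ _)⟩
  · exact h

/-- From a derived grammar in which no replacement gains more than `t` one obtains disjoint pairs
of adjacent factors of the input, in which no pair is frequent. -/
theorem IsDerived.exists_pairs {S : List (Fin σ)} {g : FullGrammar σ}
    {e : GSymbol σ → List (Fin σ)} {ρ : List (Fin σ) → List (GSymbol σ)} (h : IsDerived S g e ρ)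
    {t : ℕ} (hgain : ∀ w : List (GSymbol σ), 2 ≤ w.length → g.size ≤ (g.replace w).size + t) :
    ∃ P : List (List (Fin σ) × List (Fin σ)),
      g.size ≤ 2 * P.length + 3 * g.numNonterminals + 1 ∧ (∀ p, P.countP (fun q => q = p) ≤ t + 2) ∧
      (∀ p ∈ P, p.1 <:+: S ∧ p.2 <:+: S) ∧
      ∀ F : List (Fin σ) → ℝ, (∀ u, 0 ≤ F u) → (∀ u v, F u + F v ≤ F (u ++ v)) →
        (P.map fun p => F p.1 + F p.2).sum ≤ F S := by
  set Xs : List (GSymbol σ) := (List.range g.numNonterminals).map Sum.inr with hXs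
  obtain ⟨L, h₁, h₂, h₃⟩ := exists_cut Xs
    (List.nodup_range.map Sum.inr_injective) g.rightHandSides (by
      intro X hX
      simp only [hXs, List.mem_map, List.mem_range] at hX
      obtain ⟨i, hi, rfl⟩ := hX
      exact h.used i hi)
  have hL₁ : L.length ≤ 2 * g.numNonterminals + 1 := by
    simp only [hXs, List.length_map, List.length_range, FullGrammar.rightHandSides,
      List.length_cons, FullGrammar.numNonterminals] at *
    omega
  set Q := L.flatMap consecutivePairs with hQ
  have hQmem : ∀ p ∈ Q, (∃ r ∈ g.rightHandSides, p.1 ∈ r) ∧ ∃ r ∈ g.rightHandSides, p.2 ∈ r := by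
    intro p hp
    obtain ⟨r', hr', hp⟩ := List.mem_flatMap.1 hp
    obtain ⟨r, hr, hs⟩ := h₂ r' hr'
    exact ⟨⟨r, hr, hs _ (mem_of_mem_consecutivePairs hp).1⟩,
      ⟨r, hr, hs _ (mem_of_mem_consecutivePairs hp).2⟩⟩
  have hsumQ : ∀ F : List (GSymbol σ) → ℝ, (∀ u, 0 ≤ F u) →
      (∀ u v, F u + F v ≤ F (u ++ v)) →
      (Q.map fun p => F [p.1] + F [p.2]).sum ≤ (L.map F).sum := by
    intro F hF₀ hF
    have : ∀ L : List (List (GSymbol σ)), ((L.flatMap consecutivePairs).map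
        fun p => F [p.1] + F [p.2]).sum ≤ (L.map F).sum := by
      intro L
      induction L with
      | nil => simp
      | cons r L ih =>
        have := sum_consecutivePairs_le hF₀ hF r
        rw [List.flatMap_cons, List.map_append, List.sum_append, List.map_cons, List.sum_cons]
        linarith
    exact this L
  have hinfix : ∀ s, (∃ r ∈ g.rightHandSides, s ∈ r) → e s <:+: S := by
    rintro s ⟨r, hr, hs⟩
    refine List.IsInfix.trans ?_ (h.isInfix r hr)
    obtain ⟨p, q, rfl⟩ := List.append_of_mem hs
    exact ⟨p.flatMap e, q.flatMap e, by simp⟩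
  refine ⟨Q.map fun p => (e p.1, e p.2), ?_, ?_, ?_, ?_⟩
  · rw [List.length_map]
    -- `exists_cut` does not ask for nonnegativity, so the negated length may be used to bound from
    -- below what is left after cutting.
    have h₄ := h₃ (fun u => -(u.length : ℝ)) (fun u v => by simp [add_comm])
    have h₅ : ∀ (ι : Type) (l : List ι) (f : ι → ℕ),
        (l.map fun x => -(f x : ℝ)).sum = -((l.map f).sum : ℕ) := by
      intro ι l f
      induction l with
      | nil => simp
      | cons a l ih => simp only [List.map_cons, List.sum_cons, ih]; push_cast; ring
    rw [h₅ _ L, h₅ _ g.rightHandSides, ← g.size_eq_sum, h₅ _ Xs (fun X => [X].length)] at h₄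
    have h₆ : g.size ≤ (L.map List.length).sum + g.numNonterminals := by
      simp only [List.length_cons, List.length_nil, List.map_const', List.sum_replicate, hXs,
        List.length_map, List.length_range] at h₄
      have : (g.size : ℝ) ≤ ((L.map List.length).sum : ℕ) + (g.numNonterminals : ℝ) := by
        simp at h₄ ⊢
        linarith
      exact_mod_cast this
    -- Each of the at most `2K + 1` remaining words, `K` being the number of nonterminals, loses at
    -- most one symbol when paired; the `K` symbols cut out make this `3K + 1`.
    have h₇ : ∀ L : List (List (GSymbol σ)), (L.map List.length).sum ≤
        2 * (L.flatMap consecutivePairs).length + L.length := by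
      intro L
      induction L with
      | nil => simp
      | cons r L ih =>
        have := length_le_consecutivePairs r
        simp only [List.map_cons, List.sum_cons, List.flatMap_cons, List.length_append,
          List.length_cons]
        omega
    have := h₇ L
    rw [← hQ] at this
    omega
  · intro p
    by_cases hp : p ∈ Q.map fun p => (e p.1, e p.2)
    · obtain ⟨⟨a, b⟩, hab, rfl⟩ := List.mem_map.1 hp
      set X : GSymbol σ := Sum.inr g.numNonterminals with hX
      -- By injectivity, equal pairs of expansions come from equal pairs of symbols.
      have h₄ : (Q.map fun p => (e p.1, e p.2)).countP (fun q => q = (e a, e b)) ≤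
          Q.countP (fun q => q = (a, b)) := by
        rw [List.countP_map]
        refine List.countP_mono_left ?_
        rintro ⟨c, d⟩ hcd hc
        simp only [Function.comp_apply, decide_eq_true_eq, Prod.mk.injEq] at hc ⊢
        obtain ⟨⟨r, hr, har⟩, r', hr', hbr'⟩ := hQmem _ hab
        obtain ⟨⟨r₁, hr₁, hcr⟩, r₂, hr₂, hdr⟩ := hQmem _ hcd
        exact ⟨h.injective hr₁ hr hcr har hc.1, h.injective hr₂ hr' hdr hbr' hc.2⟩
      have h₅ : ∀ L : List (List (GSymbol σ)),
          ((L.flatMap consecutivePairs).countP (fun q => q = (a, b)) : ℝ) ≤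
            (L.map fun r => (r.length : ℝ) - (replaceAll [a, b] X r).length).sum := by
        intro L
        induction L with
        | nil => simp
        | cons r L ih =>
          have : ((replaceAll [a, b] X r).length : ℝ) +
            (consecutivePairs r).countP (fun q => q = (a, b)) ≤
            r.length := by exact_mod_cast length_replaceAll_pair_add_count (X := X) a b r
          rw [List.flatMap_cons, List.countP_append, List.map_cons, List.sum_cons]
          push_cast
          linarith
      -- The saving from replacing `a b` is superadditive, so the pieces save no more than the whole
      -- grammar, which saves at most `t` plus the 2 symbols of the new rule.
      have h₆ := h₃ (fun r => (r.length : ℝ) - (replaceAll [a, b] X r).length) (by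
        intro u v
        have : ((replaceAll [a, b] X (u ++ v)).length : ℝ) ≤
            (replaceAll [a, b] X u).length + (replaceAll [a, b] X v).length := by
          exact_mod_cast length_replaceAll_pair_append a b u v
        rw [List.length_append]
        push_cast
        linarith)
      have h₇ : ∀ Y : GSymbol σ, replaceAll [a, b] X [Y] = [Y] := fun Y =>
        replaceAll_eq_self fun hi => absurd hi.length_le (by simp)
      have h₈ : ∀ L : List (List (GSymbol σ)),
          (L.map fun r => (r.length : ℝ) - (replaceAll [a, b] X r).length).sum =
          ((L.map List.length).sum : ℕ) -
            ((L.map fun r => (replaceAll [a, b] X r).length).sum : ℕ) := by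
        intro L
        induction L with
        | nil => simp
        | cons r L ih => simp only [List.map_cons, List.sum_cons, ih]; push_cast; ring
      have h₉ := hgain [a, b] (by simp)
      have h₁₀ := h₅ L
      rw [h₈ g.rightHandSides, ← g.size_eq_sum] at h₆
      rw [g.size_replace, ← hX] at h₉
      simp only [h₇, sub_self, List.map_const', List.sum_replicate, smul_zero, add_zero] at h₆
      have h₁₁ : (g.size : ℝ) ≤ ((g.rightHandSides.map fun r =>
          (replaceAll [a, b] X r).length).sum : ℕ) + 2 + t := by exact_mod_cast h₉
      have h₁₂ : (Q.countP (fun q => q = (a, b)) : ℝ) ≤ (t + 2 : ℕ) := by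
        push_cast
        linarith
      exact h₄.trans (by exact_mod_cast h₁₂)
    · rw [List.countP_eq_zero.2 (by
        intro q hq
        simp only [decide_eq_true_eq]
        rintro rfl
        exact hp hq)]
      exact Nat.zero_le _
  · intro p hp
    obtain ⟨q, hq, rfl⟩ := List.mem_map.1 hp
    exact ⟨hinfix _ (hQmem q hq).1, hinfix _ (hQmem q hq).2⟩
  · intro F hF₀ hF
    have h₄ := h₃ (fun u => F (u.flatMap e)) (fun u v => by
      rw [List.flatMap_append]; exact hF _ _)
    have h₅ := hsumQ (fun u => F (u.flatMap e)) (fun u => hF₀ _) (fun u v => by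
      rw [List.flatMap_append]; exact hF _ _)
    -- A nonterminal and its rule have the same expansion, so the cut-out symbols cancel all rules
    -- and only `F S` remains.
    have h₆ : (Xs.map fun X => F ([X].flatMap e)) = g.rules.map fun u => F (u.flatMap e) := by
      apply List.ext_getElem
      · simp [hXs, FullGrammar.numNonterminals]
      · intro i hi hi'
        simp [hXs, h.rule i (by simpa using hi')]
    rw [h₆, FullGrammar.rightHandSides, List.map_cons, List.sum_cons, h.start] at h₄
    simp only [List.flatMap_cons, List.flatMap_nil, List.append_nil] at h₅
    rw [List.map_map]
    simp only [Function.comp_def]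
    linarith

end Invariant

/-! ### Counting occurrences -/

section Occurrences

variable {α : Type*} [DecidableEq α]

theorem occ_eq_card (w v : List α) :
    occ w v = ((Finset.range w.length).filter fun i => v <+: w.drop i).card := by
  rw [occ, List.countP_eq_length_filter]
  rfl

theorem occ_add_occ_le (x y v : List α) : occ x v + occ y v ≤ occ (x ++ y) v := by
  unfold occ
  rw [List.length_append, List.range_add, List.countP_append, List.countP_map]
  refine Nat.add_le_add ?_ ?_
  · refine List.countP_mono_left fun i hi h => ?_
    rw [List.mem_range] at hi
    rw [decide_eq_true_eq] at h ⊢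
    rw [List.drop_append_of_le_length hi.le]
    exact h.trans (List.prefix_append _ _)
  · refine List.countP_mono_left fun i hi h => ?_
    rw [decide_eq_true_eq] at h
    simpa [List.drop_append, List.drop_eq_nil_of_le] using h

theorem occ_pos_of_infix {S u : List α} (h : u <:+: S) (hu : u ≠ []) : 0 < occ S u := by
  obtain ⟨p, q, rfl⟩ := h
  rw [occ, List.countP_pos_iff]
  have := List.length_pos_of_ne_nil hu
  exact ⟨p.length, by simp; omega, by simp [List.append_assoc]⟩

theorem occ_snoc_of_suffix {y v : List α} {a : α} (h : v <:+ y) :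
    occ y (v ++ [a]) + 1 ≤ occ (y ++ [a]) (v ++ [a]) := by
  obtain ⟨x, rfl⟩ := h
  rw [occ_eq_card, occ_eq_card, ← Finset.card_insert_of_notMem (a := x.length) (by
    simp only [Finset.mem_filter, not_and]
    intro _ h
    simpa using h.length_le)]
  refine Finset.card_le_card fun i hi => ?_
  rw [Finset.mem_insert, Finset.mem_filter, Finset.mem_range] at hi
  rw [Finset.mem_filter, Finset.mem_range]
  rcases hi with rfl | ⟨hi, h⟩
  · simp [List.append_assoc]
  · refine ⟨by rw [List.length_append]; omega, ?_⟩
    rw [List.drop_append_of_le_length hi.le]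
    exact h.trans (List.prefix_append _ _)

/-- An occurrence of `v` is followed by at most one letter, and by none at the end of `S`; hence
only an inequality. -/
theorem sum_occ_snoc_le [Fintype α] (S v : List α) : ∑ a, occ S (v ++ [a]) ≤ occ S v := by
  simp only [occ_eq_card]
  rw [← Finset.card_biUnion]
  · refine Finset.card_le_card fun i hi => ?_
    simp only [Finset.mem_biUnion, Finset.mem_univ, true_and, Finset.mem_filter] at hi ⊢
    obtain ⟨a, hi, h⟩ := hi
    exact ⟨hi, (List.prefix_append _ _).trans h⟩
  · intro a _ b _ hab
    rw [Function.onFun, Finset.disjoint_left]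
    intro i hi hi'
    rw [Finset.mem_filter] at hi hi'
    have := List.prefix_of_prefix_length_le hi.2 hi'.2 (by simp)
    exact hab (by simpa using this.eq_of_length (by simp))

end Occurrences

/-! ### The entropy cost of a factor and its Kraft inequality -/

section Words

variable {σ : ℕ}

/-- The words of a given length. -/
def words (σ : ℕ) : ℕ → Finset (List (Fin σ))
  | 0 => {[]}
  | ℓ + 1 => (words σ ℓ ×ˢ Finset.univ).image fun p => p.1 ++ [p.2]

theorem mem_words {ℓ : ℕ} {y : List (Fin σ)} : y ∈ words σ ℓ ↔ y.length = ℓ := by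
  induction ℓ generalizing y with
  | zero => simp [words]
  | succ ℓ ih =>
    simp only [words, Finset.mem_image, Finset.mem_product, Finset.mem_univ, and_true, ih,
      Prod.exists]
    constructor
    · rintro ⟨y, a, rfl, rfl⟩; simp
    · intro h
      have hy : y ≠ [] := by rintro rfl; simp at h
      exact ⟨y.dropLast, y.getLast hy, by simp [h], List.dropLast_append_getLast hy⟩

theorem sum_words_succ (ℓ : ℕ) (f : List (Fin σ) → ℝ) :
    ∑ y ∈ words σ (ℓ + 1), f y = ∑ y ∈ words σ ℓ, ∑ a, f (y ++ [a]) := by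
  rw [words, Finset.sum_image, Finset.sum_product]
  rintro ⟨y, a⟩ _ ⟨z, b⟩ _ h
  simpa using h

theorem card_words (ℓ : ℕ) : (words σ ℓ).card = σ ^ ℓ := by
  induction ℓ with
  | zero => simp [words]
  | succ ℓ ih =>
    rw [words, Finset.card_image_of_injective, Finset.card_product, ih, Finset.card_univ,
      Fintype.card_fin, pow_succ]
    rintro ⟨y, a⟩ ⟨z, b⟩ h
    simpa using h

/-- The code length of the letter `a` in the context `v`, for an ideal code adapted to `S`. -/
noncomputable def letterCost {k : ℕ} (S : List (Fin σ)) (v : Fin k → Fin σ) (a : Fin σ) : ℝ :=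
  -Real.logb 2 ((occ S (List.ofFn v ++ [a]) : ℝ) / (occ S (List.ofFn v) : ℝ))

/-- The total code length of the letters of `y` that are preceded in `y` by `k` letters. -/
noncomputable def entropyCost (k : ℕ) (S y : List (Fin σ)) : ℝ :=
  ∑ v : Fin k → Fin σ, ∑ a : Fin σ, (occ y (List.ofFn v ++ [a]) : ℝ) * letterCost S v a

theorem occ_snoc_le (S v : List (Fin σ)) (a : Fin σ) : occ S (v ++ [a]) ≤ occ S v :=
  (Finset.single_le_sum (f := fun a => occ S (v ++ [a])) (fun _ _ => Nat.zero_le _)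
    (Finset.mem_univ a)).trans (sum_occ_snoc_le S v)

theorem letterCost_nonneg {k : ℕ} (S : List (Fin σ)) (v : Fin k → Fin σ) (a : Fin σ) :
    0 ≤ letterCost S v a := by
  rw [letterCost, neg_nonneg]
  refine Real.logb_nonpos one_lt_two (by positivity) (div_le_one_of_le₀ ?_ (by positivity))
  exact_mod_cast occ_snoc_le S _ a

theorem entropyCost_nonneg (k : ℕ) (S y : List (Fin σ)) : 0 ≤ entropyCost k S y :=
  Finset.sum_nonneg fun v _ => Finset.sum_nonneg fun a _ =>
    mul_nonneg (Nat.cast_nonneg _) (letterCost_nonneg S v a)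

theorem entropyCost_add_le (k : ℕ) (S x y : List (Fin σ)) :
    entropyCost k S x + entropyCost k S y ≤ entropyCost k S (x ++ y) := by
  simp only [entropyCost, ← Finset.sum_add_distrib, ← add_mul]
  refine Finset.sum_le_sum fun v _ => Finset.sum_le_sum fun a _ =>
    mul_le_mul_of_nonneg_right ?_ (letterCost_nonneg S v a)
  exact_mod_cast occ_add_occ_le x y _

theorem entropyCost_self (k : ℕ) {S : List (Fin σ)} (hS : S ≠ []) :
    entropyCost k S S = S.length * empiricalEntropy k S := by
  have : (S.length : ℝ) ≠ 0 := by simpa using hS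
  simp only [entropyCost, empiricalEntropy, letterCost, mul_neg, Finset.sum_neg_distrib]
  field_simp

theorem entropyCost_snoc {k : ℕ} (S : List (Fin σ)) {y : List (Fin σ)} (v : Fin k → Fin σ)
    (hv : List.ofFn v <:+ y) (a : Fin σ) :
    entropyCost k S y + letterCost S v a ≤ entropyCost k S (y ++ [a]) := by
  have hmono : ∀ u, occ y u ≤ occ (y ++ [a]) u := fun u =>
    (Nat.le_add_right _ _).trans (occ_add_occ_le y [a] u)
  have h₁ : letterCost S v a = ∑ v' : Fin k → Fin σ, ∑ a' : Fin σ,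
      if v' = v ∧ a' = a then letterCost S v' a' else 0 := by
    rw [Finset.sum_eq_single v, Finset.sum_eq_single a] <;> simp +contextual
  rw [h₁, entropyCost, ← Finset.sum_add_distrib]
  simp only [← Finset.sum_add_distrib]
  refine Finset.sum_le_sum fun v' _ => Finset.sum_le_sum fun a' _ => ?_
  have h₀ := letterCost_nonneg S v' a'
  split_ifs with h
  · obtain ⟨rfl, rfl⟩ := h
    have : (occ y (List.ofFn v' ++ [a']) : ℝ) + 1 ≤ occ (y ++ [a']) (List.ofFn v' ++ [a']) := by
      exact_mod_cast occ_snoc_of_suffix hv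
    nlinarith
  · rw [add_zero]
    exact mul_le_mul_of_nonneg_right (by exact_mod_cast hmono _) h₀

/-- The first `k` letters are free, which gives at most `σ ^ k` words of weight at most 1. Every
further letter multiplies the weight by at most its conditional frequency after the last `k`
letters, and these frequencies sum to at most 1. -/
theorem sum_words_entropyCost_le (k ℓ : ℕ) (hσ : 1 ≤ σ) (S : List (Fin σ)) :
    ∑ y ∈ words σ ℓ, (if y <:+: S then (2 : ℝ) ^ (-entropyCost k S y) else 0) ≤
      (σ : ℝ) ^ k := by
  have hσ' : (1 : ℝ) ≤ σ := by exact_mod_cast hσ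
  rcases Nat.lt_or_ge ℓ k with hℓ | hℓ
  · refine (Finset.sum_le_card_nsmul _ _ 1 fun y _ => ?_).trans ?_
    · split_ifs
      · exact Real.rpow_le_one_of_one_le_of_nonpos one_le_two
          (neg_nonpos.2 (entropyCost_nonneg k S y))
      · exact zero_le_one
    · rw [card_words, nsmul_eq_mul, mul_one, Nat.cast_pow]
      exact pow_le_pow_right₀ hσ' hℓ.le
  · induction ℓ, hℓ using Nat.le_induction with
    | base =>
      refine (Finset.sum_le_card_nsmul _ _ 1 fun y _ => ?_).trans ?_
      · split_ifs
        · exact Real.rpow_le_one_of_one_le_of_nonpos one_le_two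
            (neg_nonpos.2 (entropyCost_nonneg k S y))
        · exact zero_le_one
      · rw [card_words, nsmul_eq_mul, mul_one, Nat.cast_pow]
    | succ ℓ hℓ ih =>
      rw [sum_words_succ]
      refine (Finset.sum_le_sum fun y hy => ?_).trans ih
      rw [mem_words] at hy
      by_cases hyS : y <:+: S
      swap
      · rw [if_neg hyS, Finset.sum_eq_zero]
        intro a _
        rw [if_neg fun h => hyS ((List.prefix_append y [a]).isInfix.trans h)]
      set v : Fin k → Fin σ := fun i => y[ℓ - k + i]'(by have := i.2; omega) with hv
      have hvy : List.ofFn v = y.drop (ℓ - k) := by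
        apply List.ext_getElem
        · simp only [List.length_ofFn, List.length_drop]; omega
        · intro i h₁ h₂
          simp [hv]
      have hsuf : List.ofFn v <:+ y := hvy ▸ List.drop_suffix _ _
      rw [if_pos hyS]
      -- The restriction to factors of `S` matters: a zero frequency would have cost 0, since `logb
      -- 2 0 = 0`.
      have hterm : ∀ a : Fin σ, (if y ++ [a] <:+: S then
          (2 : ℝ) ^ (-entropyCost k S (y ++ [a])) else 0) ≤
          (2 : ℝ) ^ (-entropyCost k S y) *
            ((occ S (List.ofFn v ++ [a]) : ℝ) / occ S (List.ofFn v)) := by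
        intro a
        split_ifs with h
        · have hin : List.ofFn v ++ [a] <:+: S := by
            obtain ⟨x, hx⟩ := hsuf
            refine List.IsInfix.trans ?_ h
            exact ⟨x, [], by rw [← hx]; simp⟩
          have h₁ : 0 < occ S (List.ofFn v ++ [a]) := occ_pos_of_infix hin (by simp)
          have h₂ := h₁.trans_le (occ_snoc_le S _ a)
          have h₃ : (0 : ℝ) < (occ S (List.ofFn v ++ [a]) : ℝ) / occ S (List.ofFn v) := by
            positivity
          rw [← Real.rpow_logb two_pos (by norm_num) h₃, ← Real.rpow_add two_pos]
          refine Real.rpow_le_rpow_of_exponent_le one_le_two ?_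
          have := entropyCost_snoc S v hsuf a
          rw [letterCost] at this
          linarith
        · positivity
      refine (Finset.sum_le_sum fun a _ => hterm a).trans ?_
      rw [← Finset.mul_sum, ← Finset.sum_div]
      refine mul_le_of_le_one_right (by positivity) (div_le_one_of_le₀ ?_ (by positivity))
      exact_mod_cast sum_occ_snoc_le S _

end Words

/-! ### Gibbs' inequality and ideal codes for pairs of factors -/

section Coding

theorem length_mul_logb_le {γ : Type*} [DecidableEq γ] (P : List γ) (Q : γ → ℝ) (M : ℕ)
    (hM : 0 < M) (hQ : ∀ p ∈ P, 0 < Q p) (hsum : ∑ p ∈ P.toFinset, Q p ≤ 1)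
    (hcount : ∀ p, P.countP (fun q => q = p) ≤ M) :
    (P.length : ℝ) * Real.logb 2 (P.length / M) ≤ (P.map fun p => -Real.logb 2 (Q p)).sum := by
  rcases P.eq_nil_or_concat with rfl | hne
  · simp
  have hm : 0 < P.length := by
    obtain ⟨_, _, rfl⟩ := hne
    simp
  have hm' : (0 : ℝ) < P.length := by exact_mod_cast hm
  have hM' : (0 : ℝ) < M := by exact_mod_cast hM
  have h₁ : (P.map Q).sum ≤ M := by
    rw [Finset.sum_list_map_count]
    calc ∑ p ∈ P.toFinset, P.count p • Q p ≤ ∑ p ∈ P.toFinset, (M : ℝ) * Q p := by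
          refine Finset.sum_le_sum fun p hp => ?_
          rw [nsmul_eq_mul]
          refine mul_le_mul_of_nonneg_right ?_ (hQ p (List.mem_toFinset.1 hp)).le
          exact_mod_cast hcount p
      _ ≤ M := by
          rw [← Finset.mul_sum]
          exact mul_le_of_le_one_right hM'.le hsum
  -- This is `log x ≤ x - 1` at `x = Q p * (P.length / M)`, summed over a list; `P.length` stays
  -- fixed during the induction.
  have h₂ : ∀ P' : List γ, (∀ p ∈ P', 0 < Q p) →
      (P'.map fun p => Real.log (Q p)).sum + P'.length * Real.log (P.length / M) ≤
        (P'.map Q).sum * (P.length / M) - P'.length := by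
    intro P' hP'
    induction P' with
    | nil => simp
    | cons p P' ih =>
      have h₃ := ih fun q hq => hP' q (by simp [hq])
      have hp : 0 < Q p := hP' p (by simp)
      have h₄ := Real.log_le_sub_one_of_pos (mul_pos hp (div_pos hm' hM'))
      rw [Real.log_mul hp.ne' (div_pos hm' hM').ne'] at h₄
      simp only [List.map_cons, List.sum_cons, List.length_cons]
      push_cast
      linarith
  have h₃ := h₂ P hQ
  have h₄ : (P.map Q).sum * (P.length / M) ≤ P.length := by
    rw [mul_div_assoc', div_le_iff₀ hM', mul_comm (P.length : ℝ)]
    exact mul_le_mul_of_nonneg_right h₁ hm'.le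
  have h₅ : (P.map fun p => -Real.logb 2 (Q p)).sum =
      -(P.map fun p => Real.log (Q p)).sum / Real.log 2 := by
    simp only [Real.logb]
    clear * -
    induction P with
    | nil => simp
    | cons p P ih => simp only [List.map_cons, List.sum_cons, ih]; ring
  rw [h₅, Real.logb, mul_div_assoc']
  refine div_le_div_of_nonneg_right ?_ (Real.log_nonneg one_le_two)
  linarith

theorem logb_two_one_add_le {x : ℝ} (hx : 0 ≤ x) : Real.logb 2 (1 + x) ≤ 2 * x := by
  have h₁ := Real.log_le_sub_one_of_pos (show 0 < 1 + x by linarith)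
  have h₂ := Real.log_two_gt_d9
  rw [Real.logb, div_le_iff₀ (by linarith)]
  nlinarith

/-- Weights on words whose sums over words of equal length are bounded by `c` become a
subprobability when lengths are weighted geometrically with mean `B`. -/
theorem sum_geometric_le_one {σ : ℕ} {E : List (Fin σ) → ℝ} {c : ℝ} (hc : 0 < c)
    (hE₀ : ∀ y, 0 ≤ E y) (hE : ∀ ℓ, ∑ y ∈ words σ ℓ, E y ≤ c) {B : ℝ} (hB : 0 < B)
    (A : Finset (List (Fin σ))) :
    ∑ y ∈ A, E y / c * (1 / (B + 1) * (B / (B + 1)) ^ y.length) ≤ 1 := by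
  set N := A.sup List.length + 1 with hN
  have hmem : ∀ y ∈ A, y.length ∈ Finset.range N := by
    intro y hy
    rw [Finset.mem_range, hN, Nat.lt_succ_iff]
    exact Finset.le_sup (f := List.length) hy
  rw [← Finset.sum_fiberwise_of_maps_to hmem]
  have h₁ : ∀ ℓ ∈ Finset.range N, ∑ y ∈ A with y.length = ℓ,
      E y / c * (1 / (B + 1) * (B / (B + 1)) ^ y.length) ≤
      1 / (B + 1) * (B / (B + 1)) ^ ℓ := by
    intro ℓ _
    have h₂ : ∑ y ∈ A with y.length = ℓ, E y / c * (1 / (B + 1) * (B / (B + 1)) ^ y.length) =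
        (∑ y ∈ A with y.length = ℓ, E y) / c * (1 / (B + 1) * (B / (B + 1)) ^ ℓ) := by
      rw [Finset.sum_div, Finset.sum_mul]
      refine Finset.sum_congr rfl fun y hy => ?_
      rw [(Finset.mem_filter.1 hy).2]
    rw [h₂]
    refine mul_le_of_le_one_left (by positivity) (div_le_one_of_le₀ (le_trans ?_ (hE ℓ)) hc.le)
    refine Finset.sum_le_sum_of_subset_of_nonneg (fun y hy => ?_) fun y _ _ => hE₀ y
    exact mem_words.2 (Finset.mem_filter.1 hy).2
  refine (Finset.sum_le_sum h₁).trans ?_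
  have hr : B / (B + 1) ≠ 1 := by
    rw [Ne, div_eq_one_iff_eq (by positivity)]
    linarith
  rw [← Finset.mul_sum, geom_sum_eq hr]
  have h₃ : 1 / (B + 1) * (((B / (B + 1)) ^ N - 1) / (B / (B + 1) - 1)) =
      1 - (B / (B + 1)) ^ N := by
    have h₄ : B / (B + 1) - 1 = -(1 / (B + 1)) := by field_simp; ring
    have h₅ : 1 / (B + 1) ≠ 0 := by positivity
    rw [h₄]
    field_simp
    ring
  rw [h₃]
  have : 0 ≤ (B / (B + 1)) ^ N := by positivity
  linarith

/-- The code of a factor `y` has length `C y + log c` for its content and `log (B + 1) + |y| log (1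
+ 1 / B)` for its length. The factors are disjoint in `S`, so superadditivity bounds the sums of `C
y` and of `|y|`. -/
theorem length_mul_logb_le_cost {σ : ℕ} {S : List (Fin σ)}
    (P : List (List (Fin σ) × List (Fin σ))) {M : ℕ} (hM : 0 < M)
    (hcount : ∀ p, P.countP (fun q => q = p) ≤ M) (hP : ∀ p ∈ P, p.1 <:+: S ∧ p.2 <:+: S)
    (hF : ∀ F : List (Fin σ) → ℝ, (∀ u, 0 ≤ F u) → (∀ u v, F u + F v ≤ F (u ++ v)) →
        (P.map fun p => F p.1 + F p.2).sum ≤ F S)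
    {C : List (Fin σ) → ℝ} (hC₀ : ∀ y, 0 ≤ C y) (hC : ∀ x y, C x + C y ≤ C (x ++ y))
    {c : ℝ} (hc : 1 ≤ c)
    (hsum : ∀ ℓ, ∑ y ∈ words σ ℓ, (if y <:+: S then (2 : ℝ) ^ (-C y) else 0) ≤ c)
    {B : ℝ} (hB : 0 < B) :
    (P.length : ℝ) * Real.logb 2 (P.length / M) ≤
      C S + 2 * P.length * Real.logb 2 c + 2 * P.length * Real.logb 2 (B + 1) +
        2 * S.length / B := by
  have hc₀ : 0 < c := by linarith
  set E : List (Fin σ) → ℝ := fun y => if y <:+: S then (2 : ℝ) ^ (-C y) else 0 with hE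
  have hE₀ : ∀ y, 0 ≤ E y := by
    intro y
    simp only [hE]
    split_ifs <;> positivity
  set q : List (Fin σ) → ℝ := fun y => E y / c * (1 / (B + 1) * (B / (B + 1)) ^ y.length) with hq
  have hq₀ : ∀ y, 0 ≤ q y := fun y => mul_nonneg (div_nonneg (hE₀ y) hc₀.le) (by positivity)
  have hqpos : ∀ y, y <:+: S → 0 < q y := by
    intro y hy
    simp only [hq, hE, if_pos hy]
    positivity
  have hqlog : ∀ y, y <:+: S → -Real.logb 2 (q y) =
      C y + Real.logb 2 c + Real.logb 2 (B + 1) + y.length * Real.logb 2 (1 + 1 / B) := by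
    intro y hy
    have h₁ : 1 + 1 / B = (B / (B + 1))⁻¹ := by field_simp
    simp only [hq, hE, if_pos hy]
    rw [Real.logb_mul (by positivity) (by positivity), Real.logb_div (by positivity) hc₀.ne',
      Real.logb_rpow two_pos (by norm_num), Real.logb_mul (by positivity) (by positivity),
      Real.logb_pow, h₁, Real.logb_inv, one_div, Real.logb_inv]
    ring
  have h₁ := length_mul_logb_le P (fun p => q p.1 * q p.2) M hM
    (fun p hp => mul_pos (hqpos _ (hP p hp).1) (hqpos _ (hP p hp).2)) (by
      calc ∑ p ∈ P.toFinset, q p.1 * q p.2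
          ≤ ∑ p ∈ P.toFinset.image Prod.fst ×ˢ P.toFinset.image Prod.snd, q p.1 * q p.2 :=
            Finset.sum_le_sum_of_subset_of_nonneg (fun p hp => by
              rw [Finset.mem_product]
              exact ⟨Finset.mem_image_of_mem _ hp, Finset.mem_image_of_mem _ hp⟩)
              fun p _ _ => mul_nonneg (hq₀ _) (hq₀ _)
        _ = (∑ y ∈ P.toFinset.image Prod.fst, q y) * ∑ y ∈ P.toFinset.image Prod.snd, q y := by
            rw [Finset.sum_product, Finset.sum_mul_sum]
        _ ≤ 1 := mul_le_one₀ (sum_geometric_le_one hc₀ hE₀ hsum hB _)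
            (Finset.sum_nonneg fun y _ => hq₀ y) (sum_geometric_le_one hc₀ hE₀ hsum hB _))
    hcount
  refine h₁.trans ?_
  have h₂ : (P.map fun p => -Real.logb 2 (q p.1 * q p.2)).sum =
      (P.map fun p => C p.1 + C p.2).sum + 2 * P.length * Real.logb 2 c +
        2 * P.length * Real.logb 2 (B + 1) +
        (P.map fun p => (p.1.length : ℝ) + p.2.length).sum * Real.logb 2 (1 + 1 / B) := by
    clear hF hcount h₁
    induction P with
    | nil => simp
    | cons p P ih =>
      have hp := hP p (by simp)
      have h₃ := hqlog _ hp.1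
      have h₄ := hqlog _ hp.2
      simp only [List.map_cons, List.sum_cons, List.length_cons]
      rw [ih fun p hp => hP p (by simp [hp]),
        Real.logb_mul (hqpos _ hp.1).ne' (hqpos _ hp.2).ne']
      push_cast
      linear_combination h₃ + h₄
  have h₃ := hF C hC₀ hC
  have h₄ := hF (fun y => (y.length : ℝ)) (fun u => Nat.cast_nonneg _) (fun u v => by simp)
  have h₅ : 0 ≤ Real.logb 2 (1 + 1 / B) := by
    refine Real.logb_nonneg one_lt_two ?_
    have : 0 < 1 / B := by positivity
    linarith
  have h₆ : (S.length : ℝ) * Real.logb 2 (1 + 1 / B) ≤ 2 * S.length / B := by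
    refine (mul_le_mul_of_nonneg_left (logb_two_one_add_le (by positivity))
      (Nat.cast_nonneg _)).trans (le_of_eq ?_)
    ring
  have h₇ := mul_le_mul_of_nonneg_right h₄ h₅
  rw [h₂]
  linarith

theorem sum_words_uniform_le {σ : ℕ} (hσ : 1 ≤ σ) (S : List (Fin σ)) (ℓ : ℕ) :
    ∑ y ∈ words σ ℓ,
      (if y <:+: S then (2 : ℝ) ^ (-(y.length * Real.logb 2 σ)) else 0) ≤ 1 := by
  have hσ' : (0 : ℝ) < σ := by exact_mod_cast hσ
  refine (Finset.sum_le_card_nsmul _ _ (((σ : ℝ) ^ ℓ)⁻¹) fun y hy => ?_).trans ?_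
  · rw [mem_words] at hy
    split_ifs
    · rw [Real.rpow_neg zero_le_two, mul_comm, Real.rpow_mul zero_le_two,
        Real.rpow_logb two_pos (by norm_num) hσ', Real.rpow_natCast, hy]
    · positivity
  · rw [card_words, nsmul_eq_mul, Nat.cast_pow, mul_inv_cancel₀ (by positivity)]

end Coding

/-! ### The explicit bound and its asymptotics -/

section Bound

variable {σ : ℕ}

theorem length_fullyNaiveEncoding (g : FullGrammar σ) :
    (fullyNaiveEncoding g).length =
      g.size + (g.numNonterminals + 1) + g.size * Nat.clog 2 (σ + g.numNonterminals) := by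
  have h₁ : ∀ L : List (List (GSymbol σ)),
      (L.flatMap fun r => List.replicate r.length true ++ [false]).length =
        L.flatten.length + L.length := by
    intro L
    induction L with
    | nil => simp
    | cons r L ih =>
      simp only [List.flatMap_cons, List.length_append, ih, List.length_replicate,
        List.flatten_cons, List.length_cons, List.length_nil]
      omega
  have h₂ : ∀ (len : ℕ) (u : List (GSymbol σ)),
      (u.flatMap (symbolCode len)).length = u.length * len := by
    intro len u
    induction u with
    | nil => simp
    | cons s u ih =>
      rw [List.flatMap_cons, List.length_append, ih, symbolCode, List.length_ofFn,
        List.length_cons]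
      ring
  rw [fullyNaiveEncoding, List.length_append, h₁, h₂]
  simp [FullGrammar.size, FullGrammar.numNonterminals, FullGrammar.rightHandSides]

theorem IsDerived.numNonterminals_le_size {S : List (Fin σ)} {g : FullGrammar σ}
    {e : GSymbol σ → List (Fin σ)} {ρ : List (Fin σ) → List (GSymbol σ)}
    (h : IsDerived S g e ρ) : g.numNonterminals ≤ g.size := by
  have h₁ : ((List.range g.numNonterminals).map (Sum.inr : ℕ → GSymbol σ)).Nodup :=
    List.nodup_range.map Sum.inr_injective
  have h₂ : (List.range g.numNonterminals).map (Sum.inr : ℕ → GSymbol σ) ⊆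
      g.rightHandSides.flatten := by
    intro s hs
    simp only [List.mem_map, List.mem_range] at hs
    obtain ⟨i, hi, rfl⟩ := hs
    exact List.mem_flatten.2 (h.used i hi)
  simpa [FullGrammar.size] using (h₁.subperm h₂).length_le

theorem numNonterminals_le_size_of_isGreedyOutput {S : List (Fin σ)} {g : FullGrammar σ}
    (hg : IsGreedyOutput S g) : g.numNonterminals ≤ g.size := by
  have key : ∀ g, Relation.ReflTransGen GreedyStep (FullGrammar.initial S) g →
      ∃ e ρ, IsDerived S g e ρ := by
    intro g hg
    induction hg with
    | refl => exact ⟨_, _, IsDerived.initial S⟩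
    | tail _ hstep ih =>
      obtain ⟨w, hw, rfl, hs, -⟩ := hstep
      obtain ⟨e, ρ, h⟩ := ih
      exact ⟨_, _, h.replace hw hs⟩
  obtain ⟨e, ρ, h⟩ := key g hg.1
  exact h.numNonterminals_le_size

theorem natCast_clog_two_le {z : ℕ} (hz : 1 ≤ z) : (Nat.clog 2 z : ℝ) ≤ Real.logb 2 z + 1 := by
  rw [← Real.natCeil_logb_natCast]
  exact (Nat.ceil_lt_add_one (Real.logb_nonneg one_lt_two (by exact_mod_cast hz))).le

/-- This allows `log m` to be exchanged for `log n` without any lower bound on `m`. -/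
theorem mul_logb_div_le {m n a : ℝ} (hm : 0 < m) (hn : 0 < n) (ha : 0 < a) :
    m * Real.logb 2 (n / m) ≤ m * Real.logb 2 a + 2 * n / a := by
  have h₁ : n / m = a * (n / m / a) := by field_simp
  have h₂ : Real.logb 2 (n / m / a) ≤ 2 * (n / m / a) :=
    (Real.logb_le_logb_of_le one_lt_two (by positivity) (by linarith)).trans
      (logb_two_one_add_le (by positivity))
  rw [h₁, Real.logb_mul ha.ne' (by positivity), mul_add]
  have h₃ : 2 * n / a = m * (2 * (n / m / a)) := by field_simp
  rw [h₃]
  have := mul_le_mul_of_nonneg_left h₂ hm.le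
  linarith

theorem length_fullyNaiveEncoding_le {S : List (Fin σ)} {g : FullGrammar σ}
    (hg : IsGreedyOutput S g) (hσ : 2 ≤ σ) (hσS : σ ≤ S.length) (k : ℕ) {n x y : ℝ}
    (hn : n = S.length) (hx : x = Real.logb 2 n) (hy : y = Real.logb 2 (x + 3))
    (hx₄ : 4 ≤ x) (hyx : 10 * y ≤ x) :
    ((fullyNaiveEncoding g).length : ℝ) ≤ 2 * n * empiricalEntropy k S +
      n * Real.logb 2 σ *
        (16 * (k / Real.logb σ n) + (40 * (y / x) + 55 * (1 / x) + 6 * (x / n))) := by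
  have hσ' : (2 : ℝ) ≤ σ := by exact_mod_cast hσ
  have hn₂ : 2 ≤ n := by rw [hn]; exact_mod_cast hσ.trans hσS
  have hn₀ : 0 < n := by linarith
  have hx₀ : 0 < x := by linarith
  set s := Real.logb 2 σ with hs
  have hs₁ : 1 ≤ s := by
    rw [hs, Real.le_logb_iff_rpow_le one_lt_two (by linarith), Real.rpow_one]
    exact hσ'
  have hsx : k / Real.logb σ n = k * s / x := by
    rw [hx, hs, Real.logb, Real.logb, Real.logb]
    have h₁ : Real.log σ ≠ 0 := (Real.log_pos (by linarith)).ne'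
    have h₂ : Real.log n ≠ 0 := (Real.log_pos (by linarith)).ne'
    have h₃ : Real.log 2 ≠ 0 := (Real.log_pos one_lt_two).ne'
    field_simp
  have hS : S ≠ [] := by
    rintro rfl
    simp at hσS
    omega
  -- `B` is the mean of the length code and `B ^ 2` the gain threshold. At most `n / B ^ 2`
  -- nonterminals then contribute `O(n / x)` bits, while the multiplicity bound `B ^ 2 + 2 ≤ (x + 3)
  -- ^ 2` costs only `2 * y` per pair.
  set B : ℕ := ⌈x⌉₊ with hB
  have hBx : x ≤ B := Nat.le_ceil x
  have hBx' : (B : ℝ) ≤ x + 1 := (Nat.ceil_lt_add_one hx₀.le).le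
  have hB₀ : (0 : ℝ) < B := by linarith
  obtain ⟨g₁, e, ρ, h, hsize, hnum, hgain⟩ := exists_derived_of_isGreedyOutput hg (B ^ 2)
  obtain ⟨P, hP₁, hP₂, hP₃, hP₄⟩ := h.exists_pairs hgain
  set m : ℝ := (P.length : ℝ) with hm
  set K : ℝ := (g₁.numNonterminals : ℝ) with hK
  have hy₀ : 0 ≤ y := by rw [hy]; exact Real.logb_nonneg one_lt_two (by linarith)
  have hm₀ : 0 ≤ m := Nat.cast_nonneg _
  have hlogM : Real.logb 2 ((B ^ 2 + 2 : ℕ) : ℝ) ≤ 2 * y := by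
    have : 2 * y = Real.logb 2 ((x + 3) ^ 2) := by rw [Real.logb_pow, hy]; norm_num
    rw [this]
    refine Real.logb_le_logb_of_le one_lt_two (by positivity) ?_
    push_cast
    nlinarith
  have hlogB : Real.logb 2 ((B : ℝ) + 1) ≤ y := by
    rw [hy]
    exact Real.logb_le_logb_of_le one_lt_two (by positivity) (by linarith)
  have hnB : 2 * n / B ≤ 2 * n / x := div_le_div_of_nonneg_left (by linarith) hx₀ hBx
  have hmlog : m * x ≤ m * Real.logb 2 (m / (B ^ 2 + 2 : ℕ)) + 3 * m * y + 2 * n / x := by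
    rcases hm₀.eq_or_lt with hm' | hm'
    · rw [← hm']
      have : 0 ≤ 2 * n / x := by positivity
      linarith
    · have h₁ := mul_logb_div_le hm' hn₀ (show 0 < x + 3 by linarith)
      rw [Real.logb_div hn₀.ne' hm'.ne', ← hx, ← hy] at h₁
      rw [Real.logb_div hm'.ne' (by positivity)]
      have h₂ := mul_le_mul_of_nonneg_left hlogM hm'.le
      have h₃ : 2 * n / (x + 3) ≤ 2 * n / x :=
        div_le_div_of_nonneg_left (by linarith) hx₀ (by linarith)
      linarith
  have hmB := mul_le_mul_of_nonneg_left hlogB hm₀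
  -- The uniform code, with `c = 1`, gives the a priori bound `m = O(n * s / x)` below. It makes the
  -- errors `m * k * s` and `m * y` of the entropy bound `hH` negligible.
  have hU : m * x ≤ n * s + 5 * (m * y) + 4 * (n / x) := by
    have h₁ := length_mul_logb_le_cost P (Nat.succ_pos _) hP₂ hP₃ hP₄
      (C := fun y => y.length * Real.logb 2 σ)
      (fun y => mul_nonneg (Nat.cast_nonneg _) (by linarith))
      (fun u v => by rw [List.length_append]; push_cast; linarith) le_rfl
      (sum_words_uniform_le (by omega) S) hB₀
    rw [Real.logb_one, ← hm, ← hs, ← hn] at h₁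
    rw [mul_div_assoc] at hnB hmlog
    rw [mul_div_assoc] at hnB h₁
    linarith
  have hH : m * x ≤ n * empiricalEntropy k S + 2 * (m * k * s) + 5 * (m * y) + 4 * (n / x) := by
    have h₁ := length_mul_logb_le_cost P (Nat.succ_pos _) hP₂ hP₃ hP₄
      (entropyCost_nonneg k S) (entropyCost_add_le k S)
      (one_le_pow₀ (by linarith : (1 : ℝ) ≤ σ))
      (fun ℓ => sum_words_entropyCost_le k ℓ (by omega) S) hB₀
    rw [Real.logb_pow, ← hm, ← hs, ← hn, entropyCost_self k hS, ← hn] at h₁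
    rw [mul_div_assoc] at hnB hmlog
    rw [mul_div_assoc] at hnB h₁
    linarith
  -- Since `10 * y ≤ x`, the term `5 * (m * y)` is at most half of `m * x`; since `4 ≤ x` and `1 ≤
  -- s`, the term `4 * (n / x)` is at most `n * s`.
  have hmx : m ≤ 4 * (n * s / x) := by
    have h₁ : n / x ≤ n * s / 4 := by
      rw [div_le_div_iff₀ hx₀ (by norm_num)]
      have : n * 4 ≤ n * x := mul_le_mul_of_nonneg_left hx₄ hn₀.le
      have : n * x * 1 ≤ n * x * s := mul_le_mul_of_nonneg_left hs₁ (by positivity)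
      linarith
    have h₂ : m * (10 * y) ≤ m * x := mul_le_mul_of_nonneg_left hyx hm₀
    rw [mul_div_assoc', le_div_iff₀ hx₀]
    linarith
  have hKn : K * x ≤ n / x := by
    have h₁ : (B : ℝ) ^ 2 * K + g₁.size ≤ n := by rw [hn, hK]; exact_mod_cast hnum
    have h₂ : x ^ 2 ≤ (B : ℝ) ^ 2 := pow_le_pow_left₀ hx₀.le hBx 2
    have h₃ : x ^ 2 * K ≤ (B : ℝ) ^ 2 * K := mul_le_mul_of_nonneg_right h₂ (Nat.cast_nonneg _)
    have h₄ : (0 : ℝ) ≤ g₁.size := Nat.cast_nonneg _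
    rw [le_div_iff₀ hx₀]
    linarith
  have hN : (g.size : ℝ) ≤ 2 * m + 3 * K + 1 := by
    rw [hm, hK]
    exact_mod_cast hsize.trans hP₁
  have hNn : g.size ≤ S.length := hsize.trans (by omega)
  have hnumg := numNonterminals_le_size_of_isGreedyOutput hg
  -- The final grammar may have far more nonterminals than `g₁`, but no more than its size, which is
  -- at most `n`; with `σ ≤ n` this leaves at most `2 * n` symbols.
  have hclog : (Nat.clog 2 (σ + g.numNonterminals) : ℝ) ≤ x + 2 := by
    refine (natCast_clog_two_le (by omega)).trans ?_
    have h₁ : Real.logb 2 ((σ + g.numNonterminals : ℕ) : ℝ) ≤ Real.logb 2 (2 * n) := by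
      refine Real.logb_le_logb_of_le one_lt_two (by exact_mod_cast (by omega)) ?_
      rw [hn]
      exact_mod_cast (by omega)
    rw [Real.logb_mul two_ne_zero hn₀.ne', Real.logb_self_eq_one one_lt_two, ← hx] at h₁
    linarith
  have hbits : ((fullyNaiveEncoding g).length : ℝ) ≤ (2 * m + 3 * K + 1) * (x + 4) + 1 := by
    rw [length_fullyNaiveEncoding]
    push_cast
    have h₁ : (g.numNonterminals : ℝ) ≤ g.size := by exact_mod_cast hnumg
    have h₂ := mul_le_mul_of_nonneg_left hclog (Nat.cast_nonneg (α := ℝ) g.size)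
    have h₃ := mul_le_mul_of_nonneg_right hN (show 0 ≤ x + 4 by linarith)
    linarith
  have hK₀ : 0 ≤ K := Nat.cast_nonneg _
  have hKx : K * 4 ≤ K * x := mul_le_mul_of_nonneg_left hx₄ hK₀
  have e₁ : n * s * (16 * (k / Real.logb σ n) + (40 * (y / x) + 55 * (1 / x) + 6 * (x / n))) =
      4 * (4 * (n * s / x)) * (k * s) + 10 * (4 * (n * s / x)) * y + 8 * (4 * (n * s / x)) +
        23 * (n / x) * s + 6 * x * s := by
    rw [hsx]
    field_simp
    ring
  have h₁ : m * (k * s) ≤ 4 * (n * s / x) * (k * s) :=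
    mul_le_mul_of_nonneg_right hmx (by positivity)
  have h₂ : m * y ≤ 4 * (n * s / x) * y := mul_le_mul_of_nonneg_right hmx hy₀
  have h₃ : n / x * 1 ≤ n / x * s := mul_le_mul_of_nonneg_left hs₁ (by positivity)
  have h₄ : x * 1 ≤ x * s := mul_le_mul_of_nonneg_left hs₁ hx₀.le
  rw [e₁]
  linarith

theorem tendsto_greedy_error : Tendsto (fun n : ℕ =>
    40 * (Real.logb 2 (Real.logb 2 n + 3) / Real.logb 2 n) + 55 * (1 / Real.logb 2 n) +
      6 * (Real.logb 2 n / n)) atTop (nhds 0) := by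
  have hlog : Tendsto (fun n : ℕ => Real.logb 2 n) atTop atTop :=
    (Real.tendsto_logb_atTop one_lt_two).comp tendsto_natCast_atTop_atTop
  have hlogb : (Real.logb 2) =o[atTop] (id : ℝ → ℝ) := by
    have : Real.logb 2 = fun x => (Real.log 2)⁻¹ * Real.log x := by
      funext x
      rw [Real.logb, div_eq_inv_mul]
    rw [this]
    exact Real.isLittleO_log_id_atTop.const_mul_left _
  have h₁ : Tendsto (fun x : ℝ => Real.logb 2 (x + 3) / x) atTop (nhds 0) := by
    have h₂ := hlogb.comp_tendsto (tendsto_atTop_add_const_right atTop (3 : ℝ) tendsto_id)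
    refine (h₂.trans_isBigO ?_).tendsto_div_nhds_zero
    refine IsBigO.of_bound 4 ?_
    filter_upwards [eventually_ge_atTop (1 : ℝ)] with x hx
    simp only [Function.comp_apply, id_eq, Real.norm_eq_abs]
    rw [abs_of_pos (by linarith), abs_of_pos (by linarith)]
    linarith
  have h₂ : Tendsto (fun n : ℕ => Real.logb 2 n / n) atTop (nhds 0) :=
    hlogb.tendsto_div_nhds_zero.comp tendsto_natCast_atTop_atTop
  have h₃ : Tendsto (fun n : ℕ => 1 / Real.logb 2 n) atTop (nhds 0) :=
    hlog.const_div_atTop 1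
  simpa using (((h₁.comp hlog).const_mul 40).add (h₃.const_mul 55)).add (h₂.const_mul 6)

theorem eventually_greedy_threshold : ∀ᶠ n : ℕ in atTop, 4 ≤ Real.logb 2 n ∧
    10 * Real.logb 2 (Real.logb 2 n + 3) ≤ Real.logb 2 n := by
  have hlog : Tendsto (fun n : ℕ => Real.logb 2 n) atTop atTop :=
    (Real.tendsto_logb_atTop one_lt_two).comp tendsto_natCast_atTop_atTop
  filter_upwards [hlog.eventually_ge_atTop 4,
    tendsto_greedy_error.eventually (eventually_le_nhds (show (0 : ℝ) < 1 by norm_num))] with n h₁ h₂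
  refine ⟨h₁, ?_⟩
  have h₃ : 0 < Real.logb 2 n := by linarith
  have h₄ : 0 ≤ Real.logb 2 n / n := by positivity
  have h₅ : 0 ≤ 1 / Real.logb 2 n := by positivity
  have h₆ : Real.logb 2 (Real.logb 2 n + 3) / Real.logb 2 n ≤ 1 / 10 := by linarith
  rw [div_le_div_iff₀ h₃ (by norm_num)] at h₆
  linarith

end Bound

end GreedyGrammar

theorem mainTheorem9 {ι : Type*} (l : Filter ι) (σ k : ι → ℕ)
    (S : (i : ι) → List (Fin (σ i))) (g : (i : ι) → GreedyGrammar.FullGrammar (σ i))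
    (hσ : ∀ i, 2 ≤ σ i) (hσS : ∀ i, σ i ≤ (S i).length)
    (hn : Tendsto (fun i => (S i).length) l atTop)
    (hk : (fun i => (k i : ℝ)) =o[l] (fun i => Real.logb (σ i) ((S i).length : ℝ)))
    (hg : ∀ i, GreedyGrammar.IsGreedyOutput (S i) (g i)) :
    ∃ r : ι → ℝ,
      r =o[l] (fun i => ((S i).length : ℝ) * Real.logb 2 (σ i)) ∧
      ∀ i, ((GreedyGrammar.fullyNaiveEncoding (g i)).length : ℝ) ≤
        2 * ((S i).length : ℝ) * GreedyGrammar.empiricalEntropy (k i) (S i) + r i := by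
  set b : ι → ℝ := fun i => ((GreedyGrammar.fullyNaiveEncoding (g i)).length : ℝ) -
    2 * ((S i).length : ℝ) * GreedyGrammar.empiricalEntropy (k i) (S i) with hb
  -- The explicit bound holds only for long inputs, so the remainder is the positive part of the
  -- true excess, which is valid for every `i`.
  refine ⟨fun i => max (b i) 0, ?_, fun i => ?_⟩
  swap
  · have := le_max_left (b i) 0
    simp only [hb] at this ⊢
    linarith
  have hδ := (hk.tendsto_div_nhds_zero.const_mul 16).add
    (GreedyGrammar.tendsto_greedy_error.comp hn)
  rw [mul_zero, add_zero] at hδ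
  have ho := (isBigO_refl (fun i => ((S i).length : ℝ) * Real.logb 2 (σ i)) l).mul_isLittleO
    ((isLittleO_one_iff ℝ).2 hδ)
  simp only [mul_one] at ho
  refine IsBigO.trans_isLittleO (IsBigO.of_bound 1 ?_) ho
  filter_upwards [hn.eventually GreedyGrammar.eventually_greedy_threshold] with i hi
  rw [one_mul, Real.norm_of_nonneg (le_max_right _ _)]
  refine max_le ((le_trans ?_ (le_abs_self _))) (norm_nonneg _)
  rw [hb, sub_le_iff_le_add']
  exact GreedyGrammar.length_fullyNaiveEncoding_le (hg i) (hσ i) (hσS i) (k i) rfl rfl rfl hi.1 hi.2
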